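/- Let $G$ be a finite connected simple graph on $n$ vertices, let $k\ge 1$ be an integer, and suppose that $d(x)+d(y)\ge n+k$ for every edge $xy\in E(G)$. Let $X\subseteq E(G)$ be a set of edges with $|X|\le k$. Then at least one of the following holds: (a) $G$ has a spanning closed trail containing every edge of $X$, that is, a closed walk that repeats no edge, visits every vertex of $G$ and traverses every edge of $X$ (if $n=1$, the trail consisting of the single vertex is allowed); (b) $n\ge 4$ is even and $G$ is isomorphic to $K_{2,n-2}^*$, the graph obtained from the complete bipartite graph $K_{2,n-2}$ by adding an edge joining the two vertices of the part of size $2$ (these are vertices of degree $n-2$ in $K_{2,n-2}$). -/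

import Mathlib

namespace SimpleGraph

/-- A closed walk `p` is a spanning closed trail of `G` if it repeats no edge and visits every
vertex of `G`. The one-vertex trail of length `0` is allowed (it is spanning only if `G` has
a single vertex). -/
def Walk.IsSpanningClosedTrail {V : Type*} {G : SimpleGraph V} {v : V} (p : G.Walk v v) : Prop :=
  p.IsTrail ∧ ∀ w : V, w ∈ p.support

/-- The graph `K_{2,m}^*`: the complete bipartite graph `K_{2,m}` together with an extra edge
joining the two vertices of the part of size `2` (the vertices of degree `m` in `K_{2,m}`). -/
def completeBipartiteTwoStar (m : ℕ) : SimpleGraph (Fin 2 ⊕ Fin m) :=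
  completeBipartiteGraph (Fin 2) (Fin m) ⊔ edge (Sum.inl 0) (Sum.inl 1)

end SimpleGraph

/-!
Write `H = G - X`. A spanning closed trail through `X` is the same as a connected spanning set of
edges that contains `X` and has even degree everywhere (`HasEvenSpanning`, by Euler's theorem
`exists_isTrail_of_even`). Such a set exists as soon as `H` is collapsible in the sense of Catlin,
that is, as soon as `H` has connected spanning subgraphs with any prescribed even-sized set of
odd-degree vertices: prescribe the odd vertices of `X` and add `X`. Collapsible sets grow by adding
a vertex with two neighbours in the set, or a triangle that meets it, so a connected graph all of
whose edges lie in triangles is collapsible (`Connected.collapsible_univ`).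

By the degree condition `H` is connected (`connected_deleteEdges`), and an edge `uv` of `H` in no
triangle of `H` is tight (`isTight_or_exists_common`): counting shows that the neighbourhoods of `u`
and `v` in `H` partition the vertices and that every edge of `X` meets `{u, v}`. So only graphs with
a tight edge `uv` remain.

* If `uv` is the only tight edge at `u` and at `v`, the vertices split into a collapsible fan around
  `u` and one around `v`. A second edge of `H` between the fans makes `H` collapsible; otherwise
  `X ∪ {uv}` is the edge cut between them, and the parity of `|X|` decides whether `uv` is used
  (`IsTight.hasEvenSpanning_of_fans`).
* If there is a second tight edge `up`, then `v` and `p` have the same neighbours in `H`. Either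
  this makes `H` collapsible, or `v` and `p` are leaves of `H` and the triangle `uvp` is attached to a
  collapsible fan around `u`, or `H` is complete bipartite (`IsTight.hasEvenSpanning_or_star`). In the bipartite case `G` is `K_4` with `X` a perfect
  matching, which has a suitable four-cycle, or `G` is `K_{2,n-2}^*`, all of whose degrees are even
  when `n` is odd.
-/

namespace SimpleGraph

variable {V : Type*}

/-! ### Euler's theorem -/

/-- **Euler's theorem**: a finite connected graph in which every vertex has even degree has a closed
trail that traverses all edges and visits all vertices. The edge set is given as a finset `F`, so
that degrees are the cardinalities of filters of `F`. -/
theorem exists_isTrail_of_even [Finite V] {K : SimpleGraph V} (hK : K.Connected) [DecidableEq V]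
    (F : Finset (Sym2 V)) (hF : (F : Set (Sym2 V)) = K.edgeSet)
    (heven : ∀ v, Even (F.filter (v ∈ ·)).card) :
    ∃ (v : V) (p : K.Walk v v), p.IsTrail ∧ (∀ w, w ∈ p.support) ∧ ∀ e ∈ F, e ∈ p.edges := by
  classical
  have := Fintype.ofFinite V
  have : Nonempty V := hK.nonempty
  obtain ⟨u, v, p, hp, hmax⟩ := Walk.exists_isTrail_forall_isTrail_length_le_length K
  -- At an end of an open trail, an odd number of edges is used, so the trail could be prolonged.
  have huv : u = v := by
    by_contra hne
    have hodd : ¬ Even (p.edges.countP fun e => v ∈ e) := by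
      rw [hp.even_countP_edges_iff v]
      simp [hne]
    have hsub : hp.edgesFinset.filter (v ∈ ·) ⊆ F.filter (v ∈ ·) := by
      apply Finset.filter_subset_filter
      intro e he
      have : e ∈ (F : Set (Sym2 V)) := hF ▸ p.edges_subset_edgeSet he
      exact this
    have hcard : (hp.edgesFinset.filter (v ∈ ·)).card = p.edges.countP fun e => v ∈ e := by
      rw [← Multiset.coe_countP, Multiset.countP_eq_card_filter]
      rfl
    have hneq : hp.edgesFinset.filter (v ∈ ·) ≠ F.filter (v ∈ ·) := by
      intro h
      rw [← hcard, h] at hodd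
      exact hodd (heven v)
    obtain ⟨e, he, he'⟩ := Finset.exists_of_ssubset (hsub.ssubset_of_ne hneq)
    rw [Finset.mem_filter] at he
    obtain ⟨heF, y, rfl⟩ := he
    have hadj : K.Adj v y := by
      rw [← mem_edgeSet, ← hF]
      exact heF
    have hnot : s(v, y) ∉ p.edges := fun h => he' (Finset.mem_filter.2 ⟨h, by simp⟩)
    have ht : (Walk.cons hadj.symm p.reverse).IsTrail := by
      rw [Walk.isTrail_cons, Walk.edges_reverse, List.mem_reverse, Sym2.eq_swap]
      exact ⟨hp.reverse, hnot⟩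
    have h1 := hmax _ _ _ ht
    simp at h1
  subst huv
  -- A closed trail may be rotated to start at `x`, and then prolonged by an unused edge at `x`.
  have hext : ∀ x ∈ p.support, ∀ y, K.Adj x y → s(x, y) ∈ p.edges := by
    intro x hx y hxy
    by_contra hnot
    have ht : (Walk.cons hxy.symm (p.rotate x hx)).IsTrail := by
      rw [Walk.isTrail_cons]
      refine ⟨hp.rotate hx, ?_⟩
      rwa [(p.rotate_edges x hx).mem_iff, Sym2.eq_swap]
    have h1 := hmax _ _ _ ht
    simp at h1
  have hsupp : ∀ w, w ∈ p.support := by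
    intro w
    by_contra hw
    obtain ⟨q⟩ := hK.preconnected u w
    obtain ⟨d, -, hd1, hd2⟩ := q.exists_boundary_dart {x | x ∈ p.support} p.start_mem_support hw
    exact hd2 (p.snd_mem_support_of_mem_edges (hext _ hd1 _ d.adj))
  refine ⟨u, p, hp, hsupp, fun e he => ?_⟩
  have he' : e ∈ K.edgeSet := hF ▸ he
  induction e with
  | h x y => exact hext x (hsupp x) y he'

/-! ### Tight pairs -/

/-- The pair `u, v` is tight for `H` and `X` if the neighbourhoods of `u` and `v` in `H` partition
the vertex set and every edge of `X` is incident to `u` or to `v`. Such a pair is automatically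
adjacent in `H` (take `w = u`), and its edge lies in no triangle of `H`. -/
structure IsTight (H : SimpleGraph V) (X : Finset (Sym2 V)) (u v : V) : Prop where
  adj_iff : ∀ w, H.Adj u w ↔ ¬ H.Adj v w
  mem_or_mem : ∀ e ∈ X, u ∈ e ∨ v ∈ e

namespace IsTight

variable {H : SimpleGraph V} {X : Finset (Sym2 V)} {u v : V}

theorem symm (h : IsTight H X u v) : IsTight H X v u :=
  ⟨fun w => by rw [h.adj_iff w, not_not], fun e he => (h.mem_or_mem e he).symm⟩

theorem adj (h : IsTight H X u v) : H.Adj u v := by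
  rw [h.adj_iff]
  exact H.irrefl

end IsTight

variable [DecidableEq V]

/-! ### Parities of degrees -/

/-- The number of edges of `F` incident to `w`, modulo two. -/
def incidenceParity (F : Finset (Sym2 V)) (w : V) : ZMod 2 :=
  ∑ e ∈ F, if w ∈ e then 1 else 0

theorem incidenceParity_union {F D : Finset (Sym2 V)} (h : Disjoint F D) (w : V) :
    incidenceParity (F ∪ D) w = incidenceParity F w + incidenceParity D w :=
  Finset.sum_union h

@[simp] theorem incidenceParity_empty (w : V) : incidenceParity ∅ w = 0 := rfl

theorem incidenceParity_insert {F : Finset (Sym2 V)} {e : Sym2 V} (h : e ∉ F) (w : V) :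
    incidenceParity (insert e F) w = (if w ∈ e then 1 else 0) + incidenceParity F w :=
  Finset.sum_insert h

@[simp] theorem incidenceParity_singleton (e : Sym2 V) (w : V) :
    incidenceParity {e} w = if w ∈ e then 1 else 0 :=
  Finset.sum_singleton _ _

theorem incidenceParity_eq_zero_iff (F : Finset (Sym2 V)) (w : V) :
    incidenceParity F w = 0 ↔ Even (F.filter (w ∈ ·)).card := by
  rw [incidenceParity, Finset.sum_boole, ZMod.natCast_eq_zero_iff_even]

theorem incidenceParity_eq_zero_of_forall_notMem {F : Finset (Sym2 V)} {w : V}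
    (h : ∀ e ∈ F, w ∉ e) : incidenceParity F w = 0 :=
  Finset.sum_eq_zero fun e he => if_neg (h e he)

theorem sum_mem_edge (T : Finset V) {a b : V} (h : a ≠ b) :
    (∑ w ∈ T, if w ∈ s(a, b) then (1 : ZMod 2) else 0) =
      (if a ∈ T then 1 else 0) + if b ∈ T then 1 else 0 := by
  have : ∀ w, (if w ∈ s(a, b) then (1 : ZMod 2) else 0) =
      (if w = a then 1 else 0) + if w = b then 1 else 0 := by
    intro w
    simp only [Sym2.mem_iff]
    split_ifs <;> simp_all
  simp_rw [this, Finset.sum_add_distrib, Finset.sum_ite_eq']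

theorem sum_incidenceParity_eq_zero {H : SimpleGraph V} {F : Finset (Sym2 V)}
    (hF : (F : Set (Sym2 V)) ⊆ H.edgeSet) {T : Finset V} (hT : ∀ e ∈ F, ∀ w ∈ e, w ∈ T) :
    ∑ w ∈ T, incidenceParity F w = 0 := by
  unfold incidenceParity
  rw [Finset.sum_comm]
  refine Finset.sum_eq_zero fun e he => ?_
  induction e with
  | h a b =>
    have hab : H.Adj a b := hF he
    rw [sum_mem_edge T hab.ne, if_pos (hT _ he a (by simp)), if_pos (hT _ he b (by simp))]
    decide

/-! ### Collapsible sets of vertices -/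

/-- A set `S` of vertices is collapsible in `H` if every assignment `r` of parities to the vertices
of `S` with an even total is the degree parity of some set `F` of edges of `H` inside `S` that
connects `S`. This is Catlin's notion, with the set of odd vertices encoded by `r`, whose values
outside `S` do not matter. The empty set is collapsible. -/
def Collapsible (H : SimpleGraph V) (S : Finset V) : Prop :=
  ∀ r : V → ZMod 2, ∑ w ∈ S, r w = 0 →
    ∃ F : Finset (Sym2 V), (F : Set (Sym2 V)) ⊆ H.edgeSet ∧ (∀ e ∈ F, ∀ w ∈ e, w ∈ S) ∧
      (∀ w ∈ S, incidenceParity F w = r w) ∧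
      ∀ a ∈ S, ∀ b ∈ S, (fromEdgeSet (F : Set (Sym2 V))).Reachable a b

theorem Collapsible.singleton (H : SimpleGraph V) (a : V) : Collapsible H {a} := by
  intro r hr
  refine ⟨∅, by simp, by simp, ?_, ?_⟩
  · simpa using hr.symm
  · simp only [Finset.mem_singleton]
    rintro _ rfl _ rfl
    rfl

/-- Attaching `T` to a collapsible set `S`: it is enough to realise every assignment of parities on
`T` by edges that each have an end in `T` and that connect each vertex of `T` to `S`. The parities
these edges create on `S` are corrected inside `S`. -/
theorem Collapsible.union_of_forall_exists {H : SimpleGraph V} {S T : Finset V}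
    (hS : Collapsible H S) (hd : Disjoint S T)
    (h : ∀ r : V → ZMod 2, ∃ D : Finset (Sym2 V), (D : Set (Sym2 V)) ⊆ H.edgeSet ∧
      (∀ e ∈ D, ∀ w ∈ e, w ∈ S ∪ T) ∧ (∀ e ∈ D, ∃ w ∈ e, w ∈ T) ∧
      (∀ w ∈ T, incidenceParity D w = r w) ∧
      ∀ w ∈ T, ∃ s ∈ S, (fromEdgeSet (D : Set (Sym2 V))).Reachable w s) :
    Collapsible H (S ∪ T) := by
  intro r hr
  obtain ⟨D, hDH, hDin, hDT, hDr, hDconn⟩ := h r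
  have hsum : ∑ w ∈ S, (r w - incidenceParity D w) = 0 := by
    have h1 := sum_incidenceParity_eq_zero hDH hDin
    rw [Finset.sum_union hd] at h1 hr
    rw [Finset.sum_congr rfl hDr] at h1
    rw [Finset.sum_sub_distrib, sub_eq_zero]
    exact add_right_cancel (hr.trans h1.symm)
  obtain ⟨F, hFH, hFin, hFr, hFconn⟩ := hS _ hsum
  have hFT : ∀ w ∈ T, ∀ e ∈ F, w ∉ e := fun w hw e he hwe =>
    Finset.disjoint_left.1 hd (hFin e he w hwe) hw
  have hFD : Disjoint F D := by
    rw [Finset.disjoint_left]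
    intro e heF heD
    obtain ⟨w, hwe, hwT⟩ := hDT e heD
    exact hFT w hwT e heF hwe
  have hF_le : fromEdgeSet (F : Set (Sym2 V)) ≤ fromEdgeSet ((F ∪ D : Finset _) : Set (Sym2 V)) :=
    fromEdgeSet_mono (by simp)
  have hD_le : fromEdgeSet (D : Set (Sym2 V)) ≤ fromEdgeSet ((F ∪ D : Finset _) : Set (Sym2 V)) :=
    fromEdgeSet_mono (by simp)
  have hto : ∀ w ∈ S ∪ T, ∃ s ∈ S,
      (fromEdgeSet ((F ∪ D : Finset _) : Set (Sym2 V))).Reachable w s := by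
    intro w hw
    rcases Finset.mem_union.1 hw with hw | hw
    · exact ⟨w, hw, .refl _⟩
    · obtain ⟨s, hs, hws⟩ := hDconn w hw
      exact ⟨s, hs, hws.mono hD_le⟩
  refine ⟨F ∪ D, ?_, ?_, ?_, ?_⟩
  · rw [Finset.coe_union]
    exact Set.union_subset hFH hDH
  · intro e he w hwe
    rcases Finset.mem_union.1 he with he | he
    · exact Finset.mem_union_left _ (hFin e he w hwe)
    · exact hDin e he w hwe
  · intro w hw
    rw [incidenceParity_union hFD]
    rcases Finset.mem_union.1 hw with hw | hw
    · rw [hFr w hw, sub_add_cancel]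
    · rw [incidenceParity_eq_zero_of_forall_notMem (hFT w hw), zero_add, hDr w hw]
  · intro a ha b hb
    obtain ⟨s, hs, has⟩ := hto a ha
    obtain ⟨t, ht, hbt⟩ := hto b hb
    exact has.trans (((hFconn s hs t ht).mono hF_le).trans hbt.symm)

theorem zmod_two_eq_zero_or_eq_one (x : ZMod 2) : x = 0 ∨ x = 1 := by
  revert x; decide

/-- Two disjoint collapsible sets joined by two different edges have a collapsible union: the
number of joining edges that are used, one or two, adjusts the total parity on each side. -/
theorem Collapsible.union {H : SimpleGraph V} {S T : Finset V} (hS : Collapsible H S)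
    (hT : Collapsible H T) (hd : Disjoint S T) {a b a' b' : V} (ha : a ∈ S) (hb : b ∈ T)
    (ha' : a' ∈ S) (hb' : b' ∈ T) (hab : H.Adj a b) (hab' : H.Adj a' b')
    (hne : s(a, b) ≠ s(a', b')) : Collapsible H (S ∪ T) := by
  refine hS.union_of_forall_exists hd fun r => ?_
  -- `E` consists of one or both of the joining edges, according to the sum of `r` over `T`.
  obtain ⟨E, hEH, hES, habE, hsum⟩ : ∃ E : Finset (Sym2 V), (E : Set (Sym2 V)) ⊆ H.edgeSet ∧
      (∀ e ∈ E, ∃ x ∈ S, ∃ y ∈ T, e = s(x, y)) ∧ s(a, b) ∈ E ∧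
      ∑ w ∈ T, incidenceParity E w = ∑ w ∈ T, r w := by
    have haT := Finset.disjoint_left.1 hd ha
    have haT' := Finset.disjoint_left.1 hd ha'
    rcases zmod_two_eq_zero_or_eq_one (∑ w ∈ T, r w) with h | h
    · refine ⟨{s(a, b), s(a', b')}, ?_, ?_, by simp, ?_⟩
      · simp [Set.insert_subset_iff, hab, hab']
      · simp only [Finset.mem_insert, Finset.mem_singleton]
        rintro e (rfl | rfl)
        exacts [⟨a, ha, b, hb, rfl⟩, ⟨a', ha', b', hb', rfl⟩]
      · simp_rw [incidenceParity_insert (Finset.notMem_singleton.2 hne), incidenceParity_singleton]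
        rw [Finset.sum_add_distrib, sum_mem_edge T hab.ne, sum_mem_edge T hab'.ne, h]
        simp only [haT, haT', hb, hb', if_true, if_false]
        decide
    · refine ⟨{s(a, b)}, by simpa using hab, ?_, by simp, ?_⟩
      · simp only [Finset.mem_singleton]
        rintro e rfl
        exact ⟨a, ha, b, hb, rfl⟩
      · simp_rw [incidenceParity_singleton]
        rw [sum_mem_edge T hab.ne, h]
        simp [haT, hb]
  obtain ⟨F, hFH, hFin, hFr, hFconn⟩ := hT (fun w => r w - incidenceParity E w) (by
    rw [Finset.sum_sub_distrib, hsum, sub_self])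
  have hFE : Disjoint F E := by
    rw [Finset.disjoint_left]
    intro e heF heE
    obtain ⟨x, hx, y, -, rfl⟩ := hES e heE
    exact Finset.disjoint_left.1 hd hx (hFin _ heF x (by simp))
  refine ⟨F ∪ E, ?_, ?_, ?_, ?_, ?_⟩
  · rw [Finset.coe_union]
    exact Set.union_subset hFH hEH
  · intro e he w hwe
    rcases Finset.mem_union.1 he with he | he
    · exact Finset.mem_union_right _ (hFin e he w hwe)
    · obtain ⟨x, hx, y, hy, rfl⟩ := hES e he
      rcases Sym2.mem_iff.1 hwe with rfl | rfl
      exacts [Finset.mem_union_left _ hx, Finset.mem_union_right _ hy]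
  · intro e he
    rcases Finset.mem_union.1 he with he | he
    · induction e with
      | h x y => exact ⟨x, by simp, hFin _ he x (by simp)⟩
    · obtain ⟨x, hx, y, hy, rfl⟩ := hES e he
      exact ⟨y, by simp, hy⟩
  · intro w hw
    rw [incidenceParity_union hFE, hFr w hw, sub_add_cancel]
  · intro w hw
    refine ⟨a, ha, ((hFconn w hw b hb).mono (fromEdgeSet_mono (by simp))).trans ?_⟩
    refine Adj.reachable ?_
    rw [fromEdgeSet_adj, Sym2.eq_swap]
    exact ⟨Finset.mem_union_right _ habE, hab.ne'⟩

theorem Collapsible.insert_of_adj_of_adj {H : SimpleGraph V} {S : Finset V} (hS : Collapsible H S)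
    {x y z : V} (hx : x ∈ S) (hy : y ∈ S) (hxy : x ≠ y) (hz : z ∉ S) (hxz : H.Adj x z)
    (hyz : H.Adj y z) : Collapsible H (S ∪ {z}) :=
  hS.union (Collapsible.singleton H z) (by simpa using hz) hx (by simp) hy (by simp) hxz hyz (by
    simp [hxy, hxz.ne])

theorem Collapsible.union_triangle {H : SimpleGraph V} {S : Finset V} (hS : Collapsible H S)
    {x y z : V} (hx : x ∈ S) (hy : y ∉ S) (hz : z ∉ S) (hxy : H.Adj x y) (hxz : H.Adj x z)
    (hyz : H.Adj y z) : Collapsible H (S ∪ {y, z}) := by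
  have hd : Disjoint S {y, z} := by simp [Finset.disjoint_right, hy, hz]
  refine hS.union_of_forall_exists hd fun r => ?_
  -- A connected spanning subgraph of the triangle realises any parities at `y` and `z`.
  suffices h : ∃ D : Finset (Sym2 V), D ⊆ {s(x, y), s(x, z), s(y, z)} ∧
      incidenceParity D y = r y ∧ incidenceParity D z = r z ∧
      (s(x, y) ∈ D ∨ s(x, z) ∈ D ∧ s(y, z) ∈ D) ∧ (s(x, z) ∈ D ∨ s(x, y) ∈ D ∧ s(y, z) ∈ D) by
    obtain ⟨D, hD, hDy, hDz, hcy, hcz⟩ := h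
    have hadj : ∀ {p q}, H.Adj p q → s(p, q) ∈ D →
        (fromEdgeSet (D : Set (Sym2 V))).Reachable q p := fun {p q} h h' => by
      refine Adj.reachable ?_
      rw [fromEdgeSet_adj, Sym2.eq_swap]
      exact ⟨h', h.ne'⟩
    refine ⟨D, ?_, ?_, ?_, ?_, ?_⟩
    · intro e he
      have := hD he
      simp only [Finset.mem_insert, Finset.mem_singleton] at this
      rcases this with rfl | rfl | rfl <;> assumption
    · intro e he w hw
      have := hD he
      simp only [Finset.mem_insert, Finset.mem_singleton] at this
      rcases this with rfl | rfl | rfl <;> rcases Sym2.mem_iff.1 hw with rfl | rfl <;> simp [hx]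
    · intro e he
      have := hD he
      simp only [Finset.mem_insert, Finset.mem_singleton] at this
      rcases this with rfl | rfl | rfl
      exacts [⟨y, by simp⟩, ⟨z, by simp⟩, ⟨y, by simp⟩]
    · simp only [Finset.mem_insert, Finset.mem_singleton]
      rintro w (rfl | rfl) <;> assumption
    · simp only [Finset.mem_insert, Finset.mem_singleton]
      rintro w (rfl | rfl)
      · rcases hcy with h | ⟨h, h'⟩
        · exact ⟨x, hx, hadj hxy h⟩
        · exact ⟨x, hx, (hadj hyz h').symm.trans (hadj hxz h)⟩
      · rcases hcz with h | ⟨h, h'⟩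
        · exact ⟨x, hx, hadj hxz h⟩
        · exact ⟨x, hx, (hadj hyz h').trans (hadj hxy h)⟩
  have h1 := hxy.ne
  have h2 := hxz.ne
  have h3 := hyz.ne
  have e1 : s(x, y) ≠ s(x, z) := by simp [h3, h2]
  have e2 : s(x, y) ≠ s(y, z) := by simp [h1, h2]
  have e3 : s(x, z) ≠ s(y, z) := by simp [h1, h2]
  have two : (1 : ZMod 2) + 1 = 0 := by decide
  rcases zmod_two_eq_zero_or_eq_one (r y) with hy0 | hy0 <;>
    rcases zmod_two_eq_zero_or_eq_one (r z) with hz0 | hz0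
  · refine ⟨{s(x, y), s(x, z), s(y, z)}, by simp, ?_, ?_, by simp, by simp⟩ <;>
    simp [incidenceParity_insert, h1, h2, h3, h1.symm, h2.symm, h3.symm, hy0, hz0, two]
  · refine ⟨{s(x, y), s(y, z)}, by simp [Finset.insert_subset_iff], ?_, ?_, by simp, by simp⟩ <;>
    simp [incidenceParity_insert, h1, h2, h3, h1.symm, h2.symm, h3.symm, hy0, hz0, two]
  · refine ⟨{s(x, z), s(y, z)}, by simp, ?_, ?_, by simp, by simp⟩ <;>
    simp [incidenceParity_insert, h1, h2, h3, h1.symm, h2.symm, h3.symm, hy0, hz0, two]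
  · refine ⟨{s(x, y), s(x, z)}, by simp [Finset.insert_subset_iff], ?_, ?_, by simp, by simp⟩ <;>
    simp [incidenceParity_insert, h2, h3, h1.symm, h2.symm, h3.symm, hy0, hz0]

/-- Within `U`, the set `S` cannot be enlarged by a vertex with two neighbours in `S`, nor by a
triangle that meets `S`. -/
structure TriangleClosed (H : SimpleGraph V) (U S : Finset V) : Prop where
  mem_of_adj_of_adj : ∀ ⦃x y z⦄, x ∈ S → y ∈ S → x ≠ y → z ∈ U → H.Adj x z → H.Adj y z → z ∈ S
  mem_of_triangle : ∀ ⦃x y z⦄, x ∈ S → y ∈ U → z ∈ U → H.Adj x y → H.Adj x z → H.Adj y z → y ∈ S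

/-- A maximal collapsible set is closed. To prove a vertex set collapsible it therefore suffices to
reach all of its vertices by the two closure rules. -/
theorem Collapsible.exists_triangleClosed {H : SimpleGraph V} {S₀ U : Finset V}
    (h : Collapsible H S₀) (hU : S₀ ⊆ U) :
    ∃ S, S₀ ⊆ S ∧ S ⊆ U ∧ Collapsible H S ∧ TriangleClosed H U S := by
  classical
  let C := U.powerset.filter (Collapsible H)
  obtain ⟨S, hS₀, hS⟩ := C.exists_le_maximal (a := S₀) (by simp [C, h, hU])
  have hSC := hS.prop
  simp only [C, Finset.mem_filter, Finset.mem_powerset] at hSC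
  have hmax : ∀ T ⊆ U, Collapsible H (S ∪ T) → T ⊆ S := fun T hT hc => by
    have := hS.le_of_ge (y := S ∪ T) (by simp [C, hc, Finset.union_subset hSC.1 hT]) (by simp)
    exact Finset.subset_union_right.trans this
  have h1 : ∀ ⦃x y z⦄, x ∈ S → y ∈ S → x ≠ y → z ∈ U → H.Adj x z → H.Adj y z → z ∈ S := by
    intro x y z hx hy hxy hz hxz hyz
    by_contra hzS
    exact hzS (hmax {z} (by simpa using hz)
      (hSC.2.insert_of_adj_of_adj hx hy hxy hzS hxz hyz) (by simp))
  refine ⟨S, hS₀, hSC.1, hSC.2, h1, ?_⟩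
  intro x y z hx hy hz hxy hxz hyz
  by_contra hyS
  by_cases hzS : z ∈ S
  · exact hyS (h1 hx hzS hxz.ne hy hxy hyz.symm)
  · exact hyS (hmax {y, z} (by simp [Finset.insert_subset_iff, hy, hz])
      (hSC.2.union_triangle hx hyS hzS hxy hxz hyz) (by simp))

theorem collapsible_insert_of_fan {H : SimpleGraph V} {u : V} {P : Finset V}
    (hP : ∀ p ∈ P, H.Adj u p ∧ ∃ q ∈ P, H.Adj u q ∧ H.Adj p q) : Collapsible H (insert u P) := by
  obtain ⟨S, hS₀, hSU, hS, hc⟩ := (Collapsible.singleton H u).exists_triangleClosed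
    (U := insert u P) (by simp)
  have hu : u ∈ S := hS₀ (by simp)
  have : insert u P ⊆ S := by
    refine Finset.insert_subset hu fun p hp => ?_
    obtain ⟨hup, q, hq, huq, hpq⟩ := hP p hp
    exact hc.mem_of_triangle hu (by simp [hp]) (by simp [hq]) hup huq hpq
  rwa [← hSU.antisymm this]

/-- A connected graph in which every edge lies in a triangle is collapsible. -/
theorem Connected.collapsible_univ [Fintype V] {H : SimpleGraph V} (hH : H.Connected)
    (h : ∀ x y, H.Adj x y → ∃ z, H.Adj x z ∧ H.Adj y z) : Collapsible H Finset.univ := by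
  obtain ⟨a⟩ := hH.nonempty
  obtain ⟨S, hS₀, -, hS, hc⟩ := (Collapsible.singleton H a).exists_triangleClosed
    (Finset.subset_univ _)
  have : S = Finset.univ := by
    rw [Finset.eq_univ_iff_forall]
    intro b
    by_contra hb
    obtain ⟨q⟩ := hH.preconnected a b
    obtain ⟨d, -, hd1, hd2⟩ := q.exists_boundary_dart S (hS₀ (by simp)) hb
    obtain ⟨z, h1, h2⟩ := h _ _ d.adj
    exact hd2 (hc.mem_of_triangle hd1 (by simp) (by simp) d.adj h1 h2)
  rwa [← this]

/-! ### Connected even edge sets containing `X` -/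

/-- There is a set `F` of edges of `G` that contains `X`, has even degree at every vertex and
connects all vertices. -/
def HasEvenSpanning (G : SimpleGraph V) (X : Finset (Sym2 V)) : Prop :=
  ∃ F : Finset (Sym2 V), (F : Set (Sym2 V)) ⊆ G.edgeSet ∧ X ⊆ F ∧
    (∀ w, incidenceParity F w = 0) ∧ (fromEdgeSet (F : Set (Sym2 V))).Connected

theorem HasEvenSpanning.exists_isSpanningClosedTrail [Finite V] {G : SimpleGraph V}
    {X : Finset (Sym2 V)} (h : HasEvenSpanning G X) :
    ∃ (v : V) (p : G.Walk v v), p.IsSpanningClosedTrail ∧ ∀ e ∈ X, e ∈ p.edges := by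
  obtain ⟨F, hFG, hXF, hpar, hconn⟩ := h
  have hle : fromEdgeSet (F : Set (Sym2 V)) ≤ G := by
    conv_rhs => rw [← fromEdgeSet_edgeSet G]
    exact fromEdgeSet_mono hFG
  have hF : (F : Set (Sym2 V)) = (fromEdgeSet (F : Set (Sym2 V))).edgeSet := by
    rw [edgeSet_fromEdgeSet, eq_comm, sdiff_eq_left, Set.disjoint_left]
    intro e he hd
    exact G.not_isDiag_of_mem_edgeSet (hFG he) hd
  obtain ⟨v, p, hp, hsupp, hedges⟩ := exists_isTrail_of_even hconn F hF fun w =>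
    (incidenceParity_eq_zero_iff F w).1 (hpar w)
  exact ⟨v, p.mapLe hle, ⟨by simpa using hp, by simpa using hsupp⟩, fun e he => by
    simpa using hedges e (hXF he)⟩

/-- If `S` is collapsible in `H ≤ G`, then it is enough to find a set `D ⊇ X` of edges of `G` that is
even outside `S` and connects each vertex to `S`: the parities of `D` on `S` have an even total, and
are corrected by edges of `H` inside `S`, which `D` avoids. -/
theorem Collapsible.hasEvenSpanning [Fintype V] {G H : SimpleGraph V} (hHG : H ≤ G) {S : Finset V}
    (hS : Collapsible H S) (hne : S.Nonempty) {X D : Finset (Sym2 V)} (hXD : X ⊆ D)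
    (hDG : (D : Set (Sym2 V)) ⊆ G.edgeSet)
    (hDS : ∀ e ∈ D, e ∈ H.edgeSet → ∃ w ∈ e, w ∉ S)
    (hpar : ∀ w ∉ S, incidenceParity D w = 0)
    (hconn : ∀ w ∉ S, ∃ s ∈ S, (fromEdgeSet (D : Set (Sym2 V))).Reachable w s) :
    HasEvenSpanning G X := by
  have hsum : ∑ w ∈ S, incidenceParity D w = 0 := by
    have h1 : ∑ w, incidenceParity D w = 0 := sum_incidenceParity_eq_zero hDG (by simp)
    rw [← h1]
    exact Finset.sum_subset (Finset.subset_univ _) fun w _ hw => hpar w hw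
  obtain ⟨F, hFH, hFin, hFr, hFconn⟩ := hS _ hsum
  have hFD : Disjoint F D := by
    rw [Finset.disjoint_left]
    intro e heF heD
    obtain ⟨w, hwe, hwS⟩ := hDS e heD (hFH heF)
    exact hwS (hFin e heF w hwe)
  have hF_le : fromEdgeSet (F : Set (Sym2 V)) ≤ fromEdgeSet ((F ∪ D : Finset _) : Set (Sym2 V)) :=
    fromEdgeSet_mono (by simp)
  have hD_le : fromEdgeSet (D : Set (Sym2 V)) ≤ fromEdgeSet ((F ∪ D : Finset _) : Set (Sym2 V)) :=
    fromEdgeSet_mono (by simp)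
  have hto : ∀ w, ∃ s ∈ S,
      (fromEdgeSet ((F ∪ D : Finset _) : Set (Sym2 V))).Reachable w s := by
    intro w
    by_cases hw : w ∈ S
    · exact ⟨w, hw, .refl _⟩
    · obtain ⟨s, hs, hws⟩ := hconn w hw
      exact ⟨s, hs, hws.mono hD_le⟩
  refine ⟨F ∪ D, ?_, hXD.trans Finset.subset_union_right, ?_, ?_⟩
  · rw [Finset.coe_union]
    exact Set.union_subset (hFH.trans (edgeSet_mono hHG)) hDG
  · intro w
    rw [incidenceParity_union hFD]
    by_cases hw : w ∈ S
    · rw [hFr w hw, CharTwo.add_self_eq_zero]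
    · rw [hpar w hw, add_zero]
      exact incidenceParity_eq_zero_of_forall_notMem fun e he hwe => hw (hFin e he w hwe)
  · have : Nonempty V := ⟨hne.choose⟩
    refine ⟨fun a b => ?_⟩
    obtain ⟨s, hs, has⟩ := hto a
    obtain ⟨t, ht, hbt⟩ := hto b
    exact has.trans (((hFconn s hs t ht).mono hF_le).trans hbt.symm)

theorem Collapsible.hasEvenSpanning_of_univ [Fintype V] [Nonempty V] {G : SimpleGraph V}
    {X : Finset (Sym2 V)} (hX : (X : Set (Sym2 V)) ⊆ G.edgeSet)
    (h : Collapsible (G.deleteEdges (X : Set (Sym2 V))) Finset.univ) : HasEvenSpanning G X :=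
  h.hasEvenSpanning (deleteEdges_le _) Finset.univ_nonempty subset_rfl hX
    (fun e he he' => by simp [edgeSet_deleteEdges, he] at he')
    (fun w hw => absurd (Finset.mem_univ w) hw) (fun w hw => absurd (Finset.mem_univ w) hw)

/-! ### Consequences of the degree condition -/

theorem degree_le_degree_deleteEdges_add [Fintype V] (G : SimpleGraph V) [DecidableRel G.Adj]
    (X : Finset (Sym2 V)) [DecidableRel (G.deleteEdges (X : Set (Sym2 V))).Adj] (x : V) :
    G.degree x ≤ (G.deleteEdges (X : Set (Sym2 V))).degree x + (X.filter (x ∈ ·)).card := by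
  have hsub : G.neighborFinset x ⊆ (G.deleteEdges (X : Set (Sym2 V))).neighborFinset x ∪
      Finset.univ.filter (fun w => s(x, w) ∈ X) := by
    intro w hw
    by_cases h : s(x, w) ∈ X <;> simp_all
  have hinj : (Finset.univ.filter (fun w => s(x, w) ∈ X)).card ≤ (X.filter (x ∈ ·)).card := by
    refine Finset.card_le_card_of_injOn (fun w => s(x, w)) ?_ ?_
    · intro w hw
      simpa using hw
    · intro w _ w' _ h
      exact Sym2.congr_right.1 h
  rw [← card_neighborFinset_eq_degree, ← card_neighborFinset_eq_degree]
  exact (Finset.card_le_card hsub).trans ((Finset.card_union_le _ _).trans (by omega))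

/-- If an edge `xy` of `G` joined two components of `G - X`, then `xy ∈ X`, the neighbourhoods of `x`
and `y` in `G - X` would be disjoint and omit `x` and `y`, and at most `|X| + 1` incidences with `X`
would remain to make up the degree sum. -/
theorem connected_deleteEdges [Fintype V] {G : SimpleGraph V} [DecidableRel G.Adj]
    (hG : G.Connected) {k : ℕ}
    (hdeg : ∀ x y : V, G.Adj x y → Fintype.card V + k ≤ G.degree x + G.degree y)
    {X : Finset (Sym2 V)} (hXk : X.card ≤ k) : (G.deleteEdges (X : Set (Sym2 V))).Connected := by
  classical
  set H := G.deleteEdges (X : Set (Sym2 V)) with hH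
  have := hG.nonempty
  refine ⟨fun a b => ?_⟩
  by_contra hab
  obtain ⟨q⟩ := hG.preconnected a b
  obtain ⟨⟨⟨x, y⟩, hxy⟩, -, hx, hy⟩ :=
    q.exists_boundary_dart {w | H.Reachable a w} (.refl _) hab
  simp only [Set.mem_ofPred_eq] at hx hy hxy
  have hnot : ¬ H.Reachable x y := fun h => hy (hx.trans h)
  have hd : Disjoint (H.neighborFinset x) (H.neighborFinset y) := by
    rw [Finset.disjoint_left]
    intro w hw hw'
    rw [mem_neighborFinset] at hw hw'
    exact hnot (hw.reachable.trans hw'.symm.reachable)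
  have hyN : y ∉ H.neighborFinset x ∪ H.neighborFinset y := by
    simp only [Finset.mem_union, mem_neighborFinset, H.irrefl, or_false]
    exact fun h => hnot h.reachable
  have hxN : x ∉ insert y (H.neighborFinset x ∪ H.neighborFinset y) := by
    simp only [Finset.mem_insert, Finset.mem_union, mem_neighborFinset, H.irrefl, false_or, not_or]
    exact ⟨hxy.ne, fun h => hnot h.symm.reachable⟩
  have hcard := Finset.card_le_univ (insert x (insert y (H.neighborFinset x ∪ H.neighborFinset y)))
  rw [Finset.card_insert_of_notMem hxN, Finset.card_insert_of_notMem hyN,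
    Finset.card_union_of_disjoint hd, card_neighborFinset_eq_degree,
    card_neighborFinset_eq_degree] at hcard
  have hint : (X.filter (x ∈ ·) ∩ X.filter (y ∈ ·)).card ≤ 1 := by
    rw [Finset.card_le_one]
    intro e he e' he'
    simp only [Finset.mem_inter, Finset.mem_filter] at he he'
    rw [(Sym2.mem_and_mem_iff hxy.ne).1 ⟨he.1.2, he.2.2⟩,
      (Sym2.mem_and_mem_iff hxy.ne).1 ⟨he'.1.2, he'.2.2⟩]
  have hun := Finset.card_union_add_card_inter (X.filter (x ∈ ·)) (X.filter (y ∈ ·))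
  have hle : (X.filter (x ∈ ·) ∪ X.filter (y ∈ ·)).card ≤ X.card :=
    Finset.card_le_card (Finset.union_subset (Finset.filter_subset _ _) (Finset.filter_subset _ _))
  have h1 : G.degree x ≤ H.degree x + (X.filter (x ∈ ·)).card :=
    G.degree_le_degree_deleteEdges_add X x
  have h2 : G.degree y ≤ H.degree y + (X.filter (y ∈ ·)).card :=
    G.degree_le_degree_deleteEdges_add X y
  have h3 := hdeg x y hxy
  omega

/-- An edge of `G - X` that lies in no triangle of `G - X` attains equality in all the estimates of
the degree sum, hence is tight. -/
theorem isTight_or_exists_common [Fintype V] {G : SimpleGraph V} [DecidableRel G.Adj] {k : ℕ}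
    (hdeg : ∀ x y : V, G.Adj x y → Fintype.card V + k ≤ G.degree x + G.degree y)
    {X : Finset (Sym2 V)} (hXk : X.card ≤ k) {u v : V}
    (huv : (G.deleteEdges (X : Set (Sym2 V))).Adj u v) :
    (∃ w, (G.deleteEdges (X : Set (Sym2 V))).Adj u w ∧
      (G.deleteEdges (X : Set (Sym2 V))).Adj v w) ∨
    (IsTight (G.deleteEdges (X : Set (Sym2 V))) X u v ∧ X.card = k) := by
  classical
  set H := G.deleteEdges (X : Set (Sym2 V)) with hH
  refine or_iff_not_imp_left.2 fun hno => ?_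
  have huvG := deleteEdges_adj.1 huv
  have hd : Disjoint (H.neighborFinset u) (H.neighborFinset v) := by
    rw [Finset.disjoint_left]
    intro w hw hw'
    rw [mem_neighborFinset] at hw hw'
    exact hno ⟨w, hw, hw'⟩
  have hdX : Disjoint (X.filter (u ∈ ·)) (X.filter (v ∈ ·)) := by
    rw [Finset.disjoint_left]
    intro e he he'
    simp only [Finset.mem_filter] at he he'
    rw [(Sym2.mem_and_mem_iff huv.ne).1 ⟨he.2, he'.2⟩] at he
    exact huvG.2 he.1
  have hcard := Finset.card_le_univ (H.neighborFinset u ∪ H.neighborFinset v)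
  have hle : X.filter (u ∈ ·) ∪ X.filter (v ∈ ·) ⊆ X :=
    Finset.union_subset (Finset.filter_subset _ _) (Finset.filter_subset _ _)
  have hle' := Finset.card_le_card hle
  have h1 : G.degree u ≤ H.degree u + (X.filter (u ∈ ·)).card :=
    G.degree_le_degree_deleteEdges_add X u
  have h2 : G.degree v ≤ H.degree v + (X.filter (v ∈ ·)).card :=
    G.degree_le_degree_deleteEdges_add X v
  have h3 := hdeg u v huvG.1
  have h4 := Finset.card_union_of_disjoint hd
  have h5 := Finset.card_union_of_disjoint hdX
  rw [card_neighborFinset_eq_degree, card_neighborFinset_eq_degree] at h4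
  have huniv : H.neighborFinset u ∪ H.neighborFinset v = Finset.univ :=
    (Finset.card_eq_iff_eq_univ _).1 (by omega)
  have hXe : X.filter (u ∈ ·) ∪ X.filter (v ∈ ·) = X := Finset.eq_of_subset_of_card_le hle (by omega)
  refine ⟨⟨fun w => ⟨fun h h' => hno ⟨w, h, h'⟩, fun h => ?_⟩, fun e he => ?_⟩, by omega⟩
  · have : w ∈ H.neighborFinset u ∪ H.neighborFinset v := by simp [huniv]
    simpa [h] using this
  · rw [← hXe] at he
    simp only [Finset.mem_union, Finset.mem_filter] at he
    exact he.imp And.right And.right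

/-! ### A tight edge that is the only one at each of its ends -/

/-- If `uv` is the only edge at `u` without a triangle, then `u` and its other neighbours form a
collapsible set: a triangle on another edge `up` avoids `v`, which is not adjacent to `p`. -/
theorem IsTight.collapsible_insert [Fintype V] {H : SimpleGraph V} [DecidableRel H.Adj]
    {X : Finset (Sym2 V)} {u v : V} (ht : IsTight H X u v)
    (hu : ∀ p, H.Adj u p → p ≠ v → ∃ w, H.Adj u w ∧ H.Adj p w) :
    Collapsible H (insert u (Finset.univ.filter fun p => H.Adj u p ∧ p ≠ v)) := by
  apply collapsible_insert_of_fan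
  intro p hp
  simp only [Finset.mem_filter, Finset.mem_univ, true_and] at hp
  obtain ⟨w, hw, hpw⟩ := hu p hp.1 hp.2
  refine ⟨hp.1, w, ?_, hw, hpw⟩
  simp only [Finset.mem_filter, Finset.mem_univ, true_and]
  refine ⟨hw, ?_⟩
  rintro rfl
  exact (ht.adj_iff p).1 hp.1 hpw.symm

theorem sum_incidenceParity_eq_card {E : Finset (Sym2 V)} {T : Finset V}
    (h : ∀ e ∈ E, ∃ x y, x ∉ T ∧ y ∈ T ∧ e = s(x, y)) :
    ∑ w ∈ T, incidenceParity E w = (E.card : ZMod 2) := by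
  unfold incidenceParity
  rw [Finset.sum_comm, Finset.cast_card]
  refine Finset.sum_congr rfl fun e he => ?_
  obtain ⟨x, y, hx, hy, rfl⟩ := h e he
  rw [sum_mem_edge T (by rintro rfl; exact hx hy), if_neg hx, if_pos hy, zero_add]

/-- The vertices split into two collapsible fans around `u` and `v`. If `G - X` has an edge between
them other than `uv`, everything collapses. Otherwise `X` together with `uv` is the edge cut between
the fans, and `uv` is used or not according to the parity of `|X|`. -/
theorem IsTight.hasEvenSpanning_of_fans [Fintype V] {G : SimpleGraph V} {X : Finset (Sym2 V)}
    (hX : (X : Set (Sym2 V)) ⊆ G.edgeSet) (hne : X.Nonempty) {u v : V}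
    (ht : IsTight (G.deleteEdges (X : Set (Sym2 V))) X u v)
    (hu : ∀ p, (G.deleteEdges (X : Set (Sym2 V))).Adj u p → p ≠ v →
      ∃ w, (G.deleteEdges (X : Set (Sym2 V))).Adj u w ∧
        (G.deleteEdges (X : Set (Sym2 V))).Adj p w)
    (hv : ∀ p, (G.deleteEdges (X : Set (Sym2 V))).Adj v p → p ≠ u →
      ∃ w, (G.deleteEdges (X : Set (Sym2 V))).Adj v w ∧
        (G.deleteEdges (X : Set (Sym2 V))).Adj p w) : HasEvenSpanning G X := by
  classical
  have : Nonempty V := ⟨u⟩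
  have hS := ht.collapsible_insert hu
  have hT := ht.symm.collapsible_insert hv
  set H := G.deleteEdges (X : Set (Sym2 V)) with hH
  set S := insert u (Finset.univ.filter fun p => H.Adj u p ∧ p ≠ v) with hSdef
  set T := insert v (Finset.univ.filter fun p => H.Adj v p ∧ p ≠ u) with hTdef
  have huv := ht.adj
  have huvne := huv.ne
  have huvG := deleteEdges_adj.1 huv
  have hTS : ∀ w, w ∈ T ↔ w ∉ S := by
    intro w
    have := ht.adj_iff w
    simp only [hSdef, hTdef, Finset.mem_insert, Finset.mem_filter, Finset.mem_univ, true_and]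
    by_cases h1 : w = u
    · subst h1
      simp [huvne]
    · by_cases h2 : w = v
      · subst h2
        simp [h1]
      · simp only [h1, h2, false_or, ne_eq, not_false_eq_true, and_true]
        tauto
  have hdisj : Disjoint S T := by
    rw [Finset.disjoint_right]
    exact fun w hw => (hTS w).1 hw
  have huniv : S ∪ T = Finset.univ := by
    rw [Finset.eq_univ_iff_forall]
    intro w
    rw [Finset.mem_union, hTS]
    exact em _
  have huS : u ∈ S := by simp [hSdef]
  have hvT : v ∈ T := by simp [hTdef]
  by_cases hcross : ∃ a ∈ S, ∃ b ∈ T, H.Adj a b ∧ s(a, b) ≠ s(u, v)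
  · obtain ⟨a, ha, b, hb, hab, hne'⟩ := hcross
    have := hS.union hT hdisj ha hb huS hvT hab huv hne'
    rw [huniv] at this
    exact this.hasEvenSpanning_of_univ hX
  -- A vertex joined to `u` by an edge of `X` is not a neighbour of `u` in `H`, so it lies in the fan
  -- around `v`; likewise with `u` and `v` exchanged.
  have hXcross : ∀ e ∈ X, ∃ x y, x ∉ T ∧ y ∈ T ∧ e = s(x, y) := by
    intro e he
    rcases ht.mem_or_mem e he with ⟨z, rfl⟩ | ⟨z, rfl⟩
    · have hz : ¬ H.Adj u z := by
        rw [hH, deleteEdges_adj]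
        exact fun h => h.2 he
      have hzu : G.Adj u z := hX he
      refine ⟨u, z, fun h => (hTS u).1 h huS, ?_, rfl⟩
      rw [hTS, hSdef]
      simp [hz, hzu.ne']
    · have hz : ¬ H.Adj v z := by
        rw [hH, deleteEdges_adj]
        exact fun h => h.2 he
      have hzv : G.Adj v z := hX he
      refine ⟨z, v, ?_, hvT, Sym2.eq_swap⟩
      rw [hTdef]
      simp [hz, hzv.ne']
  have huvX : s(u, v) ∉ X := huvG.2
  -- An even edge set meets the cut in an even number of edges, so `uv` is added when `|X|` is odd.
  obtain ⟨E, hXE, hEG, hEcross, hsum⟩ : ∃ E : Finset (Sym2 V), X ⊆ E ∧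
      (E : Set (Sym2 V)) ⊆ G.edgeSet ∧ (∀ e ∈ E, ∃ x y, x ∉ T ∧ y ∈ T ∧ e = s(x, y)) ∧
      ∑ w ∈ T, incidenceParity E w = 0 := by
    rcases Nat.even_or_odd X.card with h | h
    · refine ⟨X, subset_rfl, hX, hXcross, ?_⟩
      rw [sum_incidenceParity_eq_card hXcross, ZMod.natCast_eq_zero_iff_even]
      exact h
    · have hcr : ∀ e ∈ insert s(u, v) X, ∃ x y, x ∉ T ∧ y ∈ T ∧ e = s(x, y) := by
        intro e he
        rcases Finset.mem_insert.1 he with rfl | he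
        · exact ⟨u, v, fun h => (hTS u).1 h huS, hvT, rfl⟩
        · exact hXcross e he
      refine ⟨insert s(u, v) X, Finset.subset_insert _ _, ?_, hcr, ?_⟩
      · rw [Finset.coe_insert]
        exact Set.insert_subset huvG.1 hX
      · rw [sum_incidenceParity_eq_card hcr, ZMod.natCast_eq_zero_iff_even,
          Finset.card_insert_of_notMem huvX]
        exact h.add_one
  obtain ⟨F, hFH, hFin, hFr, hFconn⟩ := hT _ hsum
  have hEF : Disjoint E F := by
    rw [Finset.disjoint_left]
    intro e heE heF
    obtain ⟨x, y, hx, -, rfl⟩ := hEcross e heE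
    exact hx (hFin _ heF x (by simp))
  refine hS.hasEvenSpanning (deleteEdges_le _) ⟨u, huS⟩ (D := E ∪ F)
    (hXE.trans Finset.subset_union_left) ?_ ?_ ?_ ?_
  · rw [Finset.coe_union]
    exact Set.union_subset hEG (hFH.trans (edgeSet_mono (deleteEdges_le _)))
  · intro e he _
    rcases Finset.mem_union.1 he with he | he
    · obtain ⟨x, y, -, hy, rfl⟩ := hEcross e he
      exact ⟨y, by simp, (hTS y).1 hy⟩
    · induction e with
      | h x y => exact ⟨x, by simp, (hTS x).1 (hFin _ he x (by simp))⟩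
  · intro w hw
    rw [incidenceParity_union hEF, hFr w ((hTS w).2 hw), CharTwo.add_self_eq_zero]
  · intro w hw
    obtain ⟨e, he⟩ := hne
    obtain ⟨x, y, hx, hy, rfl⟩ := hXcross e he
    refine ⟨x, by_contra fun h => hx ((hTS x).2 h),
      ((hFconn w ((hTS w).2 hw) y hy).mono (fromEdgeSet_mono (by simp))).trans ?_⟩
    refine Adj.reachable ?_
    rw [fromEdgeSet_adj, Sym2.eq_swap]
    refine ⟨Finset.mem_union_left _ (hXE he), ?_⟩
    rintro rfl
    exact hx hy

/-! ### The graphs `K_{2,m}^*` -/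

/-- The displayed adjacency condition describes `K_{2,m}^*` with `a` and `b` as the vertices of the
part of size two. -/
theorem nonempty_iso_completeBipartiteTwoStar [Fintype V] {G : SimpleGraph V} {a b : V}
    (hab : a ≠ b) (hG : ∀ x y, G.Adj x y ↔ x ≠ y ∧ (x = a ∨ x = b ∨ y = a ∨ y = b)) :
    Nonempty (G ≃g completeBipartiteTwoStar (Fintype.card V - 2)) := by
  have hcard : Fintype.card {x // x ∉ ({a, b} : Finset V)} = Fintype.card V - 2 := by
    rw [Fintype.card_subtype_compl, Fintype.card_coe, Finset.card_pair hab]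
  let e := (Fintype.equivFinOfCardEq hcard).symm
  let g : Fin 2 ⊕ Fin (Fintype.card V - 2) → V :=
    Sum.elim (fun i => if i = 0 then a else b) fun j => (e j).1
  have he : ∀ j, (e j).1 ≠ a ∧ (e j).1 ≠ b := fun j => by
    have := (e j).2
    simpa using this
  have hg : Function.Bijective g := by
    constructor
    · rintro (i | i) (j | j) h
      · fin_cases i <;> fin_cases j <;> simp_all [g]
      · fin_cases i <;> simp [g] at h
        exacts [absurd h.symm (he j).1, absurd h.symm (he j).2]
      · fin_cases j <;> simp [g] at h
        exacts [absurd h (he i).1, absurd h (he i).2]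
      · simp only [g, Sum.elim_inr] at h
        rw [e.injective (Subtype.ext h)]
    · intro x
      by_cases ha : x = a
      · exact ⟨Sum.inl 0, by simp [g, ha]⟩
      · by_cases hb : x = b
        · exact ⟨Sum.inl 1, by simp [g, hb]⟩
        · exact ⟨Sum.inr (e.symm ⟨x, by simp [ha, hb]⟩), by simp [g]⟩
  refine ⟨Iso.symm ⟨Equiv.ofBijective g hg, ?_⟩⟩
  intro p q
  simp only [Equiv.ofBijective_apply]
  rw [hG, hg.injective.ne_iff]
  rcases p with i | i <;> rcases q with j | j
  · fin_cases i <;> fin_cases j <;> simp [g, completeBipartiteTwoStar, edge_adj]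
  · fin_cases i <;> simp [g, completeBipartiteTwoStar, edge_adj]
  · fin_cases j <;> simp [g, completeBipartiteTwoStar, edge_adj]
  · simp [g, completeBipartiteTwoStar, edge_adj, he]

theorem incidenceParity_edgeFinset [Fintype V] {G : SimpleGraph V} [DecidableRel G.Adj] (w : V) :
    incidenceParity G.edgeFinset w = (G.degree w : ZMod 2) := by
  rw [incidenceParity, Finset.sum_boole, ← card_incidenceFinset_eq_degree,
    incidenceFinset_eq_filter]

/-- For odd `m`, all degrees of `K_{2,m}^*` are even: they are `m + 1` and `2`. -/
theorem hasEvenSpanning_of_odd_card [Fintype V] {G : SimpleGraph V} {a b : V}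
    (hab : a ≠ b) (hG : ∀ x y, G.Adj x y ↔ x ≠ y ∧ (x = a ∨ x = b ∨ y = a ∨ y = b))
    {X : Finset (Sym2 V)} (hX : (X : Set (Sym2 V)) ⊆ G.edgeSet) (hodd : Odd (Fintype.card V)) :
    HasEvenSpanning G X := by
  classical
  refine ⟨G.edgeFinset, by simp, ?_, ?_, ?_⟩
  · intro e he
    rw [mem_edgeFinset]
    exact hX he
  · intro w
    rw [incidenceParity_edgeFinset, ZMod.natCast_eq_zero_iff_even, ← card_neighborFinset_eq_degree]
    by_cases hw : w = a ∨ w = b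
    · have : G.neighborFinset w = Finset.univ.erase w := by
        ext x
        rw [mem_neighborFinset, hG]
        simp only [Finset.mem_erase, Finset.mem_univ, and_true]
        tauto
      rw [this, Finset.card_erase_of_mem (Finset.mem_univ _), Finset.card_univ]
      exact Nat.Odd.sub_odd hodd odd_one
    · have : G.neighborFinset w = {a, b} := by
        ext x
        rw [mem_neighborFinset, hG]
        simp only [Finset.mem_insert, Finset.mem_singleton]
        constructor
        · tauto
        · rintro (rfl | rfl) <;> tauto
      rw [this, Finset.card_pair hab]
      exact even_two
  · rw [coe_edgeFinset, fromEdgeSet_edgeSet]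
    have : Nonempty V := ⟨a⟩
    have hr : ∀ x, G.Reachable x a := by
      intro x
      by_cases h : x = a
      · rw [h]
      · exact Adj.reachable ((hG x a).2 ⟨h, by simp⟩)
    exact ⟨fun x y => (hr x).trans (hr y).symm⟩

/-! ### Two tight edges at a vertex -/

/-- If `uv` and `up` are tight, then `v` and `p` have the same neighbours. Once this common
neighbourhood contains an edge `qq'`, the triangle `vqq'` spreads to all vertices. -/
theorem IsTight.collapsible_univ_of_adj [Fintype V] {H : SimpleGraph V} {X : Finset (Sym2 V)}
    (hH : ∀ x y, H.Adj x y → (∃ w, H.Adj x w ∧ H.Adj y w) ∨ IsTight H X x y)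
    {u v p : V} (hvp : v ≠ p) (hv : IsTight H X u v) (hp : IsTight H X u p) {q q' : V}
    (hq : H.Adj v q) (hq' : H.Adj v q') (hqq' : H.Adj q q') : Collapsible H Finset.univ := by
  have hpv : ∀ w, H.Adj v w → H.Adj p w := fun w h => by
    rwa [hp.symm.adj_iff, ← hv.symm.adj_iff]
  obtain ⟨S, hS₀, -, hS, hc⟩ := (Collapsible.singleton H v).exists_triangleClosed
    (Finset.subset_univ _)
  have hcn : ∀ {x y z}, x ∈ S → y ∈ S → x ≠ y → H.Adj x z → H.Adj y z → z ∈ S :=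
    fun hx hy hxy => hc.mem_of_adj_of_adj hx hy hxy (Finset.mem_univ _)
  have hct : ∀ {x y z}, x ∈ S → H.Adj x y → H.Adj x z → H.Adj y z → y ∈ S :=
    fun hx => hc.mem_of_triangle hx (Finset.mem_univ _) (Finset.mem_univ _)
  have hvS : v ∈ S := hS₀ (by simp)
  have hqS : q ∈ S := hct hvS hq hq' hqq'
  have hqS' : q' ∈ S := hct hvS hq' hq hqq'.symm
  have hpS : p ∈ S := hcn hqS hqS' hqq'.ne (hpv q hq).symm (hpv q' hq').symm
  have hN : ∀ w, H.Adj v w → w ∈ S := fun w h => hcn hvS hpS hvp h (hpv w h)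
  have huS : u ∈ S := hN u hv.adj.symm
  have : S = Finset.univ := by
    rw [Finset.eq_univ_iff_forall]
    intro w
    by_cases hw : H.Adj v w
    · exact hN w hw
    · have huw : H.Adj u w := (hv.adj_iff w).2 hw
      rcases hH u w huw with ⟨z, huz, hwz⟩ | ht
      · exact hct huS huw huz hwz
      · -- If `uw` is tight, then `w` has the same neighbours as `v`, in particular `q` and `q'`.
        have h : ∀ {x}, H.Adj v x → H.Adj x w := fun hx => by
          rw [adj_comm, ht.symm.adj_iff, hv.adj_iff, not_not]
          exact hx
        exact hcn hqS hqS' hqq'.ne (h hq) (h hq')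
  rwa [← this]

/-- If `uv` and `up` are tight and `u` is the only neighbour of `v`, hence of `p`, in `G - X`, then
`X` consists of the edge `vp`, and the triangle `uvp` is attached to the fan of the other
vertices around `u`. -/
theorem IsTight.hasEvenSpanning_of_leaves [Fintype V] {G : SimpleGraph V} {X : Finset (Sym2 V)}
    (hX : (X : Set (Sym2 V)) ⊆ G.edgeSet) (hne : X.Nonempty)
    (hH : ∀ x y, (G.deleteEdges (X : Set (Sym2 V))).Adj x y →
      (∃ w, (G.deleteEdges (X : Set (Sym2 V))).Adj x w ∧
        (G.deleteEdges (X : Set (Sym2 V))).Adj y w) ∨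
      IsTight (G.deleteEdges (X : Set (Sym2 V))) X x y)
    {u v p : V} (hvp : v ≠ p) (hv : IsTight (G.deleteEdges (X : Set (Sym2 V))) X u v)
    (hp : IsTight (G.deleteEdges (X : Set (Sym2 V))) X u p)
    (hleaf : ∀ q, (G.deleteEdges (X : Set (Sym2 V))).Adj v q → q = u) : HasEvenSpanning G X := by
  classical
  set H := G.deleteEdges (X : Set (Sym2 V)) with hHdef
  have hadj : ∀ w, w ≠ u → H.Adj u w := fun w hw => by
    rw [hv.adj_iff]
    exact fun h => hw (hleaf w h)
  have hXe : ∀ e ∈ X, e = s(v, p) := by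
    intro e he
    have hu : u ∉ e := by
      rintro ⟨z, rfl⟩
      have hz : G.Adj u z := hX he
      exact (deleteEdges_adj.1 (hadj z hz.ne')).2 he
    exact (Sym2.mem_and_mem_iff hvp).1
      ⟨(hv.mem_or_mem e he).resolve_left hu, (hp.mem_or_mem e he).resolve_left hu⟩
  have hvpX : s(v, p) ∈ X := by
    obtain ⟨e, he⟩ := hne
    rwa [← hXe e he]
  have huv := hv.adj
  have hup := hp.adj
  have hS : Collapsible H (insert u (Finset.univ.filter fun w => H.Adj u w ∧ w ≠ v ∧ w ≠ p)) := by
    apply collapsible_insert_of_fan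
    intro w hw
    simp only [Finset.mem_filter, Finset.mem_univ, true_and] at hw
    obtain ⟨huw, hwv, hwp⟩ := hw
    rcases hH u w huw with ⟨z, huz, hwz⟩ | ht
    · refine ⟨huw, z, ?_, huz, hwz⟩
      simp only [Finset.mem_filter, Finset.mem_univ, true_and]
      refine ⟨huz, ?_, ?_⟩
      · rintro rfl
        exact (hv.adj_iff w).1 huw hwz.symm
      · rintro rfl
        exact (hp.adj_iff w).1 huw hwz.symm
    · have := ht.mem_or_mem _ hvpX
      simp only [Sym2.mem_iff] at this
      rcases this with (h | h) | (h | h)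
      exacts [absurd h huv.ne, absurd h hup.ne, absurd h hwv, absurd h hwp]
  set S := insert u (Finset.univ.filter fun w => H.Adj u w ∧ w ≠ v ∧ w ≠ p) with hSdef
  have hvS : v ∉ S := by simp [hSdef, huv.ne']
  have hpS : p ∉ S := by simp [hSdef, hup.ne']
  have huS : u ∈ S := by simp [hSdef]
  have hcompl : ∀ w ∉ S, w = v ∨ w = p := by
    intro w hw
    simp only [hSdef, Finset.mem_insert, Finset.mem_filter, Finset.mem_univ, true_and,
      not_or] at hw
    have := hadj w hw.1
    tauto
  have e1 : s(u, v) ≠ s(u, p) := by simp [hvp, hup.ne]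
  have e2 : s(u, v) ≠ s(v, p) := by simp [huv.ne, hup.ne]
  have e3 : s(u, p) ≠ s(v, p) := by simp [huv.ne, hup.ne]
  refine hS.hasEvenSpanning (deleteEdges_le _) ⟨u, huS⟩ (D := {s(u, v), s(u, p), s(v, p)})
    ?_ ?_ ?_ ?_ ?_
  · intro e he
    simp [hXe e he]
  · have h1 : G.Adj u v := deleteEdges_le _ huv
    have h2 : G.Adj u p := deleteEdges_le _ hup
    have h3 : G.Adj v p := hX hvpX
    simp [Set.insert_subset_iff, h1, h2, h3]
  · simp only [Finset.mem_insert, Finset.mem_singleton]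
    rintro e (rfl | rfl | rfl) -
    exacts [⟨v, by simp, hvS⟩, ⟨p, by simp, hpS⟩, ⟨v, by simp, hvS⟩]
  · have two : (1 : ZMod 2) + 1 = 0 := by decide
    intro w hw
    have h1 := huv.ne
    have h2 := hup.ne
    rcases hcompl w hw with rfl | rfl <;>
    simp [incidenceParity_insert, h1, h2, h1.symm, h2.symm, hvp, hvp.symm, two]
  · intro w hw
    refine ⟨u, huS, Adj.reachable ?_⟩
    rw [fromEdgeSet_adj]
    rcases hcompl w hw with rfl | rfl
    · exact ⟨by simp [Sym2.eq_swap], huv.ne'⟩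
    · exact ⟨by simp [Sym2.eq_swap], hup.ne'⟩

theorem hasEvenSpanning_of_four_cycle [Fintype V] {G : SimpleGraph V} {X : Finset (Sym2 V)}
    {u v p q : V} (hV : ∀ w, w = u ∨ w = v ∨ w = p ∨ w = q) (huv : G.Adj u v) (hvp : G.Adj v p)
    (hpq : G.Adj p q) (hqu : G.Adj q u) (hup : u ≠ p) (hvq : v ≠ q)
    (hX : X ⊆ {s(u, v), s(v, p), s(p, q), s(q, u)}) : HasEvenSpanning G X := by
  have h1 := huv.ne
  have h2 := hvp.ne
  have h3 := hpq.ne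
  have h4 := hqu.ne
  refine (Collapsible.singleton G u).hasEvenSpanning le_rfl ⟨u, by simp⟩ hX ?_ ?_ ?_ ?_
  · simp [Set.insert_subset_iff, huv, hvp, hpq, hqu]
  · simp only [Finset.mem_insert, Finset.mem_singleton]
    rintro e (rfl | rfl | rfl | rfl) -
    exacts [⟨v, by simp, h1.symm⟩, ⟨v, by simp, h1.symm⟩, ⟨p, by simp, hup.symm⟩, ⟨q, by simp, h4⟩]
  · have two : (1 : ZMod 2) + 1 = 0 := by decide
    intro w hw
    rw [Finset.mem_singleton] at hw
    rcases hV w with rfl | rfl | rfl | rfl <;>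
    simp_all [incidenceParity_insert, h1.symm, h2.symm, h3.symm, h4.symm, hup.symm, hvq.symm]
  · intro w hw
    rw [Finset.mem_singleton] at hw
    refine ⟨u, by simp, ?_⟩
    have hvr : (fromEdgeSet (({s(u, v), s(v, p), s(p, q), s(q, u)} : Finset (Sym2 V)) :
        Set (Sym2 V))).Reachable v u :=
      Adj.reachable ((fromEdgeSet_adj _).2 ⟨by simp [Sym2.eq_swap], h1.symm⟩)
    have hqr : (fromEdgeSet (({s(u, v), s(v, p), s(p, q), s(q, u)} : Finset (Sym2 V)) :
        Set (Sym2 V))).Reachable q u :=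
      Adj.reachable ((fromEdgeSet_adj _).2 ⟨by simp, h4⟩)
    have hpr : (fromEdgeSet (({s(u, v), s(v, p), s(p, q), s(q, u)} : Finset (Sym2 V)) :
        Set (Sym2 V))).Reachable p v :=
      Adj.reachable ((fromEdgeSet_adj _).2 ⟨by simp [Sym2.eq_swap], h2.symm⟩)
    rcases hV w with rfl | rfl | rfl | rfl
    exacts [absurd rfl hw, hvr, hpr.trans hvr, hqr]

/-- Let `uv` and `up` be tight and let `Y` be the common neighbourhood of `v` and `p` in `G - X`.
Either everything collapses, or `v` and `p` are leaves of `G - X`, or `G - X` is complete bipartite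
with parts `Y` and its complement `Z`. In the last case every edge of `G - X` is tight, so an edge
of `X` contains all of `Y` or all of `Z`; hence `G` is `K_4`, where the four-cycle on both edges of
`X` works, or `G` is `K_{2,m}^*`. -/
theorem IsTight.hasEvenSpanning_or_star [Fintype V] {G : SimpleGraph V} {X : Finset (Sym2 V)}
    (hX : (X : Set (Sym2 V)) ⊆ G.edgeSet) (hne : X.Nonempty)
    (hH : ∀ x y, (G.deleteEdges (X : Set (Sym2 V))).Adj x y →
      (∃ w, (G.deleteEdges (X : Set (Sym2 V))).Adj x w ∧
        (G.deleteEdges (X : Set (Sym2 V))).Adj y w) ∨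
      IsTight (G.deleteEdges (X : Set (Sym2 V))) X x y)
    {u v p : V} (hvp : v ≠ p) (hv : IsTight (G.deleteEdges (X : Set (Sym2 V))) X u v)
    (hp : IsTight (G.deleteEdges (X : Set (Sym2 V))) X u p) :
    HasEvenSpanning G X ∨ 4 ≤ Fintype.card V ∧ ∃ a b, a ≠ b ∧
      ∀ x y, G.Adj x y ↔ x ≠ y ∧ (x = a ∨ x = b ∨ y = a ∨ y = b) := by
  classical
  have : Nonempty V := ⟨u⟩
  by_cases hleaf : ∀ q, (G.deleteEdges (X : Set (Sym2 V))).Adj v q → q = u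
  · exact .inl (hv.hasEvenSpanning_of_leaves hX hne hH hvp hp hleaf)
  push Not at hleaf
  obtain ⟨q₀, hq₀, hq₀u⟩ := hleaf
  by_cases hind : ∃ q q', (G.deleteEdges (X : Set (Sym2 V))).Adj v q ∧
      (G.deleteEdges (X : Set (Sym2 V))).Adj v q' ∧ (G.deleteEdges (X : Set (Sym2 V))).Adj q q'
  · obtain ⟨q, q', hq, hq', hqq'⟩ := hind
    exact .inl ((hv.collapsible_univ_of_adj hH hvp hp hq hq' hqq').hasEvenSpanning_of_univ hX)
  push Not at hind
  by_cases hind' : ∃ z z', ¬ (G.deleteEdges (X : Set (Sym2 V))).Adj v z ∧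
      ¬ (G.deleteEdges (X : Set (Sym2 V))).Adj v z' ∧ (G.deleteEdges (X : Set (Sym2 V))).Adj z z'
  all_goals
    set H := G.deleteEdges (X : Set (Sym2 V)) with hHdef
    have hpv : ∀ w, H.Adj p w ↔ H.Adj v w := fun w => by
      rw [hp.symm.adj_iff, ← hv.symm.adj_iff]
    have huY := hv.adj.symm
    have hY : ∀ q, H.Adj v q → IsTight H X v q := fun q hq =>
      (hH v q hq).resolve_left fun ⟨z, hvz, hqz⟩ => hind q z hq hvz hqz
  · obtain ⟨z, z', hz, hz', hzz'⟩ := hind'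
    left
    obtain ⟨S, hS₀, -, hS, hc⟩ := (Collapsible.singleton H u).exists_triangleClosed
      (Finset.subset_univ _)
    have hcn : ∀ {x y z}, x ∈ S → y ∈ S → x ≠ y → H.Adj x z → H.Adj y z → z ∈ S :=
      fun hx hy hxy => hc.mem_of_adj_of_adj hx hy hxy (Finset.mem_univ _)
    have huS : u ∈ S := hS₀ (by simp)
    have hzS : z ∈ S := hc.mem_of_triangle huS (Finset.mem_univ _) (Finset.mem_univ _)
      ((hv.adj_iff z).2 hz) ((hv.adj_iff z').2 hz') hzz'
    have hzS' : z' ∈ S := hc.mem_of_triangle huS (Finset.mem_univ _) (Finset.mem_univ _)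
      ((hv.adj_iff z').2 hz') ((hv.adj_iff z).2 hz) hzz'.symm
    have hYZ : ∀ {q w}, H.Adj v q → ¬ H.Adj v w → H.Adj q w := fun {q w} hq hw =>
      ((hY q hq).symm.adj_iff w).2 hw
    have hYS : ∀ q, H.Adj v q → q ∈ S := fun q hq =>
      hcn hzS hzS' hzz'.ne (hYZ hq hz).symm (hYZ hq hz').symm
    have hS' : S = Finset.univ := by
      rw [Finset.eq_univ_iff_forall]
      intro w
      by_cases hw : H.Adj v w
      · exact hYS w hw
      · exact hcn huS (hYS q₀ hq₀) hq₀u.symm (hYZ huY hw) (hYZ hq₀ hw)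
    rw [hS'] at hS
    exact hS.hasEvenSpanning_of_univ hX
  push Not at hind'
  have hbip : ∀ x y, H.Adj x y ↔ (H.Adj v x ↔ ¬ H.Adj v y) := by
    intro x y
    by_cases hx : H.Adj v x
    · simp only [hx, true_iff]
      exact (hY x hx).symm.adj_iff y
    · by_cases hy : H.Adj v y
      · simp only [hx, hy, not_true, iff_true]
        exact (((hY y hy).symm.adj_iff x).2 hx).symm
      · simp only [hx, hy, not_false_iff, iff_true, iff_false]
        exact hind' x y hx hy
  have htight : ∀ z q, ¬ H.Adj v z → H.Adj v q → IsTight H X z q := by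
    intro z q hz hq
    refine (hH z q ((hbip z q).2 (by simp [hz, hq]))).resolve_left ?_
    rintro ⟨w, hzw, hqw⟩
    rw [hbip] at hzw hqw
    tauto
  have hvZ : ¬ H.Adj v v := H.irrefl
  have hpZ : ¬ H.Adj v p := fun h => H.irrefl ((hpv p).2 h)
  have hXe : ∀ e ∈ X, (e = s(v, p) ∧ ∀ z, ¬ H.Adj v z → z = v ∨ z = p) ∨
      (e = s(u, q₀) ∧ ∀ q, H.Adj v q → q = u ∨ q = q₀) := by
    intro e he
    by_cases h : ∀ q, H.Adj v q → q ∈ e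
    · right
      have heq : e = s(u, q₀) := (Sym2.mem_and_mem_iff hq₀u.symm).1 ⟨h u huY, h q₀ hq₀⟩
      refine ⟨heq, fun q hq => ?_⟩
      have := h q hq
      rwa [heq, Sym2.mem_iff] at this
    · left
      push Not at h
      obtain ⟨q, hq, hqe⟩ := h
      have hZ : ∀ z, ¬ H.Adj v z → z ∈ e := fun z hz =>
        ((htight z q hz hq).mem_or_mem e he).resolve_right hqe
      have heq : e = s(v, p) := (Sym2.mem_and_mem_iff hvp).1 ⟨hZ v hvZ, hZ p hpZ⟩
      refine ⟨heq, fun z hz => ?_⟩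
      have := hZ z hz
      rwa [heq, Sym2.mem_iff] at this
  have hGadj : ∀ x y, G.Adj x y ↔ H.Adj x y ∨ s(x, y) ∈ X := by
    intro x y
    rw [hHdef, deleteEdges_adj]
    by_cases h : s(x, y) ∈ X
    · simp only [h, or_true, iff_true]
      exact hX h
    · simp [h]
  have hneYZ : ∀ {y z}, H.Adj v y → ¬ H.Adj v z → y ≠ z := by
    rintro y z hy hz rfl
    exact hz hy
  have hcard : 4 ≤ Fintype.card V := by
    have : ({v, p, u, q₀} : Finset V).card = 4 := by
      rw [Finset.card_insert_of_notMem, Finset.card_insert_of_notMem, Finset.card_pair hq₀u.symm]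
      · simp [(hneYZ huY hpZ).symm, (hneYZ hq₀ hpZ).symm]
      · simp [hvp, (hneYZ huY hvZ).symm, (hneYZ hq₀ hvZ).symm]
    rw [← this]
    exact Finset.card_le_univ _
  by_cases h1 : s(v, p) ∈ X <;> by_cases h2 : s(u, q₀) ∈ X
  · left
    have hZ := ((hXe _ h1).resolve_right fun h => by
      have : v ∈ s(u, q₀) := h.1 ▸ Sym2.mem_mk_left v p
      rcases Sym2.mem_iff.1 this with h | h
      exacts [hneYZ huY hvZ h.symm, hneYZ hq₀ hvZ h.symm]).2
    have hY' := ((hXe _ h2).resolve_left fun h => by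
      have : u ∈ s(v, p) := h.1 ▸ Sym2.mem_mk_left u q₀
      rcases Sym2.mem_iff.1 this with h | h
      exacts [hneYZ huY hvZ h, hneYZ huY hpZ h]).2
    refine hasEvenSpanning_of_four_cycle (u := v) (v := p) (p := q₀) (q := u) ?_
      ((hGadj _ _).2 (.inr h1)) ((hGadj _ _).2 (.inl ((hpv _).2 hq₀)))
      ((hGadj _ _).2 (.inr (Sym2.eq_swap ▸ h2))) ((hGadj _ _).2 (.inl huY.symm))
      (hneYZ hq₀ hvZ).symm (hneYZ huY hpZ).symm ?_
    · intro w
      by_cases hw : H.Adj v w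
      · have := hY' w hw
        tauto
      · have := hZ w hw
        tauto
    · intro e he
      rcases hXe e he with h | h
      · simp [h.1]
      · simp [h.1, Sym2.eq_swap]
  · right
    have hXvp : ∀ e ∈ X, e = s(v, p) ∧ ∀ z, ¬ H.Adj v z → z = v ∨ z = p := fun e he =>
      (hXe e he).resolve_right fun h => h2 (h.1 ▸ he)
    have hZ := (hXvp _ h1).2
    refine ⟨hcard, v, p, hvp, fun x y => ?_⟩
    have hxX : s(x, y) ∈ X ↔ s(x, y) = s(v, p) := ⟨fun h => (hXvp _ h).1, fun h => h ▸ h1⟩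
    have hx : ¬ H.Adj v x ↔ x = v ∨ x = p := ⟨hZ x, by rintro (rfl | rfl) <;> assumption⟩
    have hy : ¬ H.Adj v y ↔ y = v ∨ y = p := ⟨hZ y, by rintro (rfl | rfl) <;> assumption⟩
    rw [hGadj, hxX, hbip, Sym2.eq_iff]
    grind
  · right
    have hXuq : ∀ e ∈ X, e = s(u, q₀) ∧ ∀ q, H.Adj v q → q = u ∨ q = q₀ := fun e he =>
      (hXe e he).resolve_left fun h => h1 (h.1 ▸ he)
    have hY' := (hXuq _ h2).2
    refine ⟨hcard, u, q₀, hq₀u.symm, fun x y => ?_⟩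
    have hxX : s(x, y) ∈ X ↔ s(x, y) = s(u, q₀) := ⟨fun h => (hXuq _ h).1, fun h => h ▸ h2⟩
    have hx : H.Adj v x ↔ x = u ∨ x = q₀ := ⟨hY' x, by rintro (rfl | rfl) <;> assumption⟩
    have hy : H.Adj v y ↔ y = u ∨ y = q₀ := ⟨hY' y, by rintro (rfl | rfl) <;> assumption⟩
    rw [hGadj, hxX, hbip, Sym2.eq_iff]
    grind
  · obtain ⟨e, he⟩ := hne
    rcases hXe e he with h | h
    exacts [absurd (h.1 ▸ he) h1, absurd (h.1 ▸ he) h2]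

end SimpleGraph

open SimpleGraph in
theorem theorem7 {V : Type*} [Fintype V] (G : SimpleGraph V) [DecidableRel G.Adj]
    (hG : G.Connected) (k : ℕ) (hk : 1 ≤ k)
    (hdeg : ∀ x y : V, G.Adj x y → Fintype.card V + k ≤ G.degree x + G.degree y)
    (X : Finset (Sym2 V)) (hX : (X : Set (Sym2 V)) ⊆ G.edgeSet) (hXk : X.card ≤ k) :
    (∃ (v : V) (p : G.Walk v v), p.IsSpanningClosedTrail ∧ ∀ e ∈ X, e ∈ p.edges) ∨
      (4 ≤ Fintype.card V ∧ Even (Fintype.card V) ∧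
        Nonempty (G ≃g SimpleGraph.completeBipartiteTwoStar (Fintype.card V - 2))) := by
  classical
  have := hG.nonempty
  have hconn := connected_deleteEdges hG hdeg hXk
  have hH := fun x y => isTight_or_exists_common (u := x) (v := y) hdeg hXk
  have hH' := fun x y h => (hH x y h).imp_right And.left
  suffices h : HasEvenSpanning G X ∨ 4 ≤ Fintype.card V ∧ ∃ a b, a ≠ b ∧
      ∀ x y, G.Adj x y ↔ x ≠ y ∧ (x = a ∨ x = b ∨ y = a ∨ y = b) by
    rcases h with h | ⟨h4, a, b, hab, h⟩
    · exact .inl h.exists_isSpanningClosedTrail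
    · rcases Nat.even_or_odd (Fintype.card V) with hn | hn
      · exact .inr ⟨h4, hn, nonempty_iso_completeBipartiteTwoStar hab h⟩
      · exact .inl (hasEvenSpanning_of_odd_card hab h hX hn).exists_isSpanningClosedTrail
  by_cases hall : ∀ x y, (G.deleteEdges (X : Set (Sym2 V))).Adj x y →
      ∃ z, (G.deleteEdges (X : Set (Sym2 V))).Adj x z ∧ (G.deleteEdges (X : Set (Sym2 V))).Adj y z
  · exact .inl ((hconn.collapsible_univ hall).hasEvenSpanning_of_univ hX)
  push Not at hall
  obtain ⟨u, v, huv, hno⟩ := hall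
  obtain ⟨ht, hcard⟩ := (hH u v huv).resolve_left fun ⟨z, h, h'⟩ => hno z h h'
  have hne : X.Nonempty := Finset.card_pos.1 (by omega)
  by_cases hu : ∃ p, p ≠ v ∧ IsTight (G.deleteEdges (X : Set (Sym2 V))) X u p
  · obtain ⟨p, hpv, hp⟩ := hu
    exact ht.hasEvenSpanning_or_star hX hne hH' hpv.symm hp
  by_cases hv : ∃ p, p ≠ u ∧ IsTight (G.deleteEdges (X : Set (Sym2 V))) X v p
  · obtain ⟨p, hpu, hp⟩ := hv
    exact ht.symm.hasEvenSpanning_or_star hX hne hH' hpu.symm hp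
  refine .inl (ht.hasEvenSpanning_of_fans hX hne ?_ ?_)
  · exact fun p hp hpv => (hH' u p hp).resolve_right fun h => hu ⟨p, hpv, h⟩
  · exact fun p hp hpu => (hH' v p hp).resolve_right fun h => hv ⟨p, hpu, h⟩
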